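/- Let $n$ be a non-negative integer and let $M_n=F_n/F_n''$ be the free metabelian group of rank $n$, where $F_n$ is the free group of rank $n$ and $F_n''$ is its second derived subgroup. The group $M_n$ acts on itself by inner automorphisms; this gives the canonical homomorphism $\iota\colon M_n\to \mathrm{Aut}(M_n)$, which is injective for $n\ge 2$ and by which $M_n$ is then identified with the normal subgroup of inner automorphisms. (1) Let $\rho$ be a finite-dimensional linear representation of the automorphism group $\mathrm{Aut}(M_n)$ over a field $k$. Then the image $\rho(M_n)$ (that is, $\rho(\iota(M_n))$) is a virtually nilpotent group, i.e. it contains a nilpotent subgroup of finite index. (2) For $n>1$ the group $\mathrm{Aut}(M_n)$ is not linear, i.e. it is not isomorphic to a subgroup of $GL_m(k)$ for any field $k$ and any integer $m\ge 1$. -/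

import Mathlib

universe u v

/-- The free metabelian group `F_n / F_n''` of rank `n`, where `F_n` is the free group on `n`
generators and `F_n''` is its second derived subgroup. -/
abbrev FreeMetabelianGroup (n : ℕ) : Type :=
  FreeGroup (Fin n) ⧸ derivedSeries (FreeGroup (Fin n)) 2

/-- A group is linear (over fields in the universe `u`) if it is isomorphic to a subgroup of
`GL_m(k)` for some field `k` and some integer `m ≥ 1`. -/
def IsLinearGroup (G : Type v) [Group G] : Prop :=
  ∃ (k : Type u) (_ : Field k) (m : ℕ) (_ : 1 ≤ m)
    (H : Subgroup (Matrix.GeneralLinearGroup (Fin m) k)), Nonempty (G ≃* H)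

/-!
Let `M` be the free metabelian group of rank `n ≥ 2`, with derived subgroup `M'`, and let `ρ` be a
homomorphism from `Aut M` to the units of a finite-dimensional `k`-algebra `B`. Throughout, `M` is
mapped to `Aut M` by conjugation.

The elements `ρ(M')` span a commutative finite-dimensional algebra `R ⊆ B`, normalized by
`ρ(Aut M)`, and `M` acts on `R` by conjugation through the abelian group `M / M'`. Two finiteness
arguments bring this action under control.

* `R` has only finitely many `k`-algebra homomorphisms to an algebraic closure of `k`. A subgroup of
  finite index in `M` fixes them all, hence acts trivially modulo the nilradical `J` of `R`
  (`exists_finiteIndex_sub_mem_nilradical`).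
* The image of `M` in `End R` spans a commutative algebra `E`, on which `Aut M` acts as well. The
  algebra homomorphisms from `E` to the algebraic closure restrict to a finite set of characters of
  `M`, stable under `Aut M`. If `χ` is one of them and `φ` is the transvection `x ↦ x * y`, `y ↦ y`,
  then the characters `χ ∘ φ ^ t` take the values `χ(x) χ(y) ^ t` at `x`; as they are finitely many,
  `χ(y)` is a root of unity (`isOfFinOrder_of_transvection`). So all these characters are trivial on
  a subgroup of finite index in `M`, whose elements therefore act unipotently on `R`
  (`exists_finiteIndex_unipotent_filtration`).

On the intersection `H` of the two subgroups, commutators land in `ρ(M')`, and the two properties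
give a chain of ideals of `R`, from `0` to `R`, such that `h l - l` lies in the next smaller ideal
for `l` in an ideal of the chain and `h ∈ H`. Since `[a, h] - 1` is, up to sign and a unit, equal to
`h (a - 1) h⁻¹ - (a - 1)`, the congruence subgroups of this chain form a central series, and `ρ(H)`
is nilpotent (`isNilpotent_of_unipotent_action`).

If `n ≤ 1`, the group `M` is abelian and its inner automorphisms are trivial. For the failure of
linearity when `n ≥ 2`, the group of inner automorphisms of `M` would be virtually nilpotent, hence
so would `M`, as a central extension of it. But `M` maps onto the metabelian group
generated by `x ↦ 2 x` and `x ↦ x + 1`, in which no nontrivial power of the dilation lies in a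
nilpotent subgroup together with a nontrivial power of the translation
(`RationalAffineGroup.eq_zero_of_mem_nilpotent`).
-/

open scoped commutatorElement

/-! ### Commutative algebras spanned by commuting units -/

section FiniteDimensional
variable {k R : Type*} [Field k] [CommRing R] [Algebra k R] [Module.Finite k R]

/-- The residue fields of `R` are finite extensions of `k`, so they embed in its algebraic closure and
every prime ideal is the kernel of a homomorphism to it. -/
theorem mem_nilradical_of_forall_algHom_eq_zero {r : R}
    (h : ∀ χ : R →ₐ[k] AlgebraicClosure k, χ r = 0) : r ∈ nilradical R := by
  rw [mem_nilradical, nilpotent_iff_mem_prime]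
  intro p _
  have : Algebra.IsIntegral k (R ⧸ p) := inferInstance
  have : IsArtinianRing (R ⧸ p) := IsArtinianRing.of_finite k _
  have : IsField (R ⧸ p) := IsArtinianRing.isField_of_isDomain _
  let _ := this.toField
  let ψ : (R ⧸ p) →ₐ[k] AlgebraicClosure k := IsAlgClosed.lift
  have := h (ψ.comp (Ideal.Quotient.mkₐ k p))
  simp only [AlgHom.comp_apply, Ideal.Quotient.mkₐ_eq_mk, map_eq_zero] at this
  exact Ideal.Quotient.eq_zero_iff_mem.mp this

end FiniteDimensional

open scoped IsMulCommutative in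
/-- If a normal subgroup `N` of `G` has commuting images in `Bˣ`, then the commutative subalgebra `R`
of `B` that these images generate carries an action of `G` by conjugation. The algebra is given
abstractly, with its embedding `f` in `B`, the action `σ` and the map `j` from `N` to `R`. -/
theorem exists_commRing_conj_action {k G : Type*} {B : Type u} [Field k] [Ring B] [Algebra k B]
    [Module.Finite k B] [Group G] (τ : G →* Bˣ) (N : Subgroup G) [N.Normal]
    (hN : ∀ x ∈ N, ∀ y ∈ N, τ x * τ y = τ y * τ x) :
    ∃ (R : Type u) (_ : CommRing R) (_ : Algebra k R) (_ : Module.Finite k R)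
      (f : R →ₐ[k] B) (σ : G →* (R ≃ₐ[k] R)) (j : N →* R), Function.Injective f ∧
      (∀ g r, f (σ g r) = τ g * f r * ↑(τ g)⁻¹) ∧ (∀ x, f (j x) = τ x) ∧
      Algebra.adjoin k (Set.range j) = ⊤ := by
  let s : Set B := Set.range (fun x : N => (τ x : B))
  have hs : ∀ a ∈ s, ∀ b ∈ s, a * b = b * a := by
    rintro _ ⟨x, rfl⟩ _ ⟨y, rfl⟩
    exact congrArg Units.val (hN x x.2 y y.2)
  have := Algebra.isMulCommutative_adjoin k hs
  let R := Algebra.adjoin k s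
  let c : G →* (B →ₐ[k] B) :=
    { toFun := fun g =>
        { toFun := fun b => τ g * b * ↑(τ g)⁻¹
          map_one' := by simp
          map_mul' := fun a b => by simp [mul_assoc]
          map_zero' := by simp
          map_add' := fun a b => by simp [mul_add, add_mul]
          commutes' := fun a => by
            rw [← Algebra.commutes, mul_assoc, Units.mul_inv, mul_one] }
      map_one' := by ext; simp
      map_mul' := fun a b => by ext; simp [mul_assoc] }
  have hc : ∀ g, R ≤ R.comap (c g) := by
    intro g
    refine Algebra.adjoin_le ?_
    rintro _ ⟨x, rfl⟩
    refine Algebra.subset_adjoin ⟨⟨g * x * g⁻¹, Subgroup.Normal.conj_mem ‹_› _ x.2 _⟩, ?_⟩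
    simp [c]
  let e : G →* (R →ₐ[k] R) :=
    { toFun := fun g => ((c g).comp R.val).codRestrict R (fun r => hc g r.2)
      map_one' := by ext; simp
      map_mul' := fun a b => by
        ext r
        change c (a * b) r = c a (c b r)
        rw [map_mul]
        rfl }
  let σ : G →* (R ≃ₐ[k] R) :=
    (AlgEquiv.algHomUnitsEquiv k R).toMonoidHom.comp e.toHomUnits
  let j : N →* R :=
    { toFun := fun x => ⟨τ x, Algebra.subset_adjoin ⟨x, rfl⟩⟩
      map_one' := by ext; simp
      map_mul' := fun a b => by ext; simp }
  refine ⟨R, inferInstance, inferInstance, inferInstance, R.val, σ, j, Subtype.val_injective,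
    fun g r => rfl, fun x => rfl, ?_⟩
  have := Algebra.adjoin_adjoin_coe_preimage (R := k) (s := s)
  rw [← this]
  congr 1
  ext x
  constructor
  · rintro ⟨y, rfl⟩
    exact ⟨y, rfl⟩
  · rintro ⟨y, hy⟩
    exact ⟨y, Subtype.ext hy⟩

/-! ### Unipotent actions on commutative algebras and nilpotency -/

section Nilpotent
variable {k Γ R : Type*} [CommRing k] [Group Γ] [CommRing R] [Algebra k R] (σ : Γ →* (R ≃ₐ[k] R))

/-- The ideal of those `l ∈ I` that the group fixes modulo the ideal `K`. It is closed under
multiplication by `r` because `g (r l) - r l = r (g l - l) + (g r - r) g l`, whence the hypothesis. -/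
def Ideal.coboundaryIdeal (I K : Ideal R)
    (h : ∀ (g : Γ) (r : R), ∀ l ∈ I, (σ g r - r) * σ g l ∈ K) : Ideal R where
  carrier := {l | l ∈ I ∧ ∀ g, σ g l - l ∈ K}
  zero_mem' := ⟨I.zero_mem, by simp⟩
  add_mem' := fun {a b} ha hb => ⟨I.add_mem ha.1 hb.1, fun g => by
    have := K.add_mem (ha.2 g) (hb.2 g)
    rw [map_add]
    convert this using 1
    ring⟩
  smul_mem' := fun r l hl => ⟨I.mul_mem_left r hl.1, fun g => by
    have := K.add_mem (K.mul_mem_left r (hl.2 g)) (h g r l hl.1)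
    rw [smul_eq_mul, map_mul]
    convert this using 1
    ring⟩

theorem map_mem_pow_of_sub_mem {J : Ideal R} (hJ : ∀ g r, σ g r - r ∈ J) (i : ℕ) (g : Γ)
    {r : R} (hr : r ∈ J ^ i) : σ g r ∈ J ^ i := by
  have h1 : J ≤ J.comap (σ g) := fun x hx => by
    have := J.add_mem (hJ g x) hx
    simpa using this
  have h2 := (Ideal.pow_right_mono h1 i).trans (Ideal.le_comap_pow (σ g) i)
  exact h2 hr

/-- A group `Γ` is nilpotent if it has a normal subgroup `A` containing all commutators and embedding
equivariantly in the multiplicative monoid of a commutative algebra `R` on which `Γ` acts, trivially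
modulo a nilpotent ideal `J`, and unipotently. Unipotence is expressed by the filtration `W`. It
cannot be dropped, and neither can triviality modulo `J`: in characteristic `2` the swap of the
factors of `k × k` is unipotent, but it can generate with the units a group that is not nilpotent. -/
theorem isNilpotent_of_unipotent_action (A : Subgroup Γ) [A.Normal]
    (hA : ∀ x y : Γ, ⁅x, y⁆ ∈ A) (j : A →* R) (hj : Function.Injective j)
    (hσ : ∀ (g : Γ) (a b : A), (b : Γ) = g * a * g⁻¹ → j b = σ g (j a))
    (J : Ideal R) (hJnil : IsNilpotent J) (hJ : ∀ g r, σ g r - r ∈ J)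
    (W : ℕ → Set R) (d : ℕ) (hW0 : W 0 ⊆ {0}) (hWd : W d = Set.univ)
    (hW : ∀ t, ∀ r ∈ W (t + 1), ∀ g, σ g r - r ∈ W t) : Group.IsNilpotent Γ := by
  let Good : Ideal R → Prop := fun K =>
    ∃ n, ∀ a : A, j a - 1 ∈ K → (a : Γ) ∈ Subgroup.upperCentralSeries Γ n
  -- Inside `A`, `[a, y] - 1 = (y (a - 1) - (a - 1)) * (-(y a⁻¹ y⁻¹))`.
  have step : ∀ K K' : Ideal R, Good K' → (∀ l ∈ K, ∀ g, σ g l - l ∈ K') → Good K := by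
    rintro K K' ⟨n, hn⟩ hK
    refine ⟨n + 1, fun a ha => ?_⟩
    rw [Subgroup.mem_upperCentralSeries_succ_iff]
    intro y
    have hmem : y * (a⁻¹ : A) * y⁻¹ ∈ A := Subgroup.Normal.conj_mem ‹_› _ (a⁻¹).2 _
    have hmem' : y * a * y⁻¹ ∈ A := Subgroup.Normal.conj_mem ‹_› _ a.2 _
    have := hn (a * ⟨_, hmem⟩) ?_
    · simpa [commutatorElement_def, mul_assoc] using this
    · have h1 := hσ y a ⟨_, hmem'⟩ rfl
      have h2 : j ⟨_, hmem'⟩ * j ⟨_, hmem⟩ = 1 := by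
        rw [← map_mul, ← map_one j]
        congr 1
        ext
        simp
      have h3 := K'.mul_mem_right (-j ⟨_, hmem⟩) (hK _ ha y)
      convert h3 using 1
      rw [map_mul, map_sub, map_one, ← h1]
      linear_combination h2
  -- The terms of `W` are not ideals, so between `J ^ (i + 1)` and `J ^ i` the chain is built from
  -- ideals that contain `J ^ i ∩ W t`.
  have inner : ∀ i, Good (J ^ (i + 1)) → Good (J ^ i) := by
    intro i hi
    have key : ∀ t, ∃ K : Ideal R, J ^ (i + 1) ≤ K ∧ (∀ l ∈ J ^ i, l ∈ W t → l ∈ K) ∧ Good K := by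
      intro t
      induction t with
      | zero =>
        refine ⟨J ^ (i + 1), le_rfl, fun l _ hl => ?_, hi⟩
        rw [hW0 hl]
        exact Ideal.zero_mem _
      | succ t ih =>
        obtain ⟨K, hK1, hK2, hK3⟩ := ih
        refine ⟨Ideal.coboundaryIdeal σ (J ^ i) K fun g r l hl => hK1 ?_, ?_, ?_, ?_⟩
        · rw [pow_succ']
          exact Ideal.mul_mem_mul (hJ g r) (map_mem_pow_of_sub_mem σ hJ i g hl)
        · exact fun l hl => ⟨Ideal.pow_le_pow_right (Nat.le_succ i) hl, fun g => hK1 <|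
            Ideal.sub_mem _ (map_mem_pow_of_sub_mem σ hJ _ g hl) hl⟩
        · exact fun l hl hlW => ⟨hl, fun g => hK2 _
            (Ideal.sub_mem _ (map_mem_pow_of_sub_mem σ hJ i g hl) hl) (hW t l hlW g)⟩
        · exact step _ K hK3 fun l hl => hl.2
    obtain ⟨K, -, hK2, n, hn⟩ := key d
    exact ⟨n, fun a ha => hn a (hK2 _ ha (by simp [hWd]))⟩
  obtain ⟨p, hp⟩ := hJnil
  have base : Good (J ^ p) := by
    refine ⟨0, fun a ha => ?_⟩
    rw [hp, Ideal.zero_eq_bot, Ideal.mem_bot, sub_eq_zero, ← map_one j] at ha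
    simp [hj ha]
  have all : ∀ q, q ≤ p → Good (J ^ (p - q)) := by
    intro q
    induction q with
    | zero => exact fun _ => base
    | succ q ih =>
      intro hq
      apply inner
      have := ih (by lia)
      rwa [show p - (q + 1) + 1 = p - q by lia]
  obtain ⟨n, hn⟩ := all p le_rfl
  refine ⟨n + 1, ?_⟩
  rw [eq_top_iff]
  intro x _
  rw [Subgroup.mem_upperCentralSeries_succ_iff]
  intro y
  exact hn ⟨_, hA x y⟩ (by simp)

end Nilpotent

/-! ### Subgroups of finite index acting unipotently -/

/-- The subgroup consists of the elements that fix each of the finitely many algebra homomorphisms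
from `R` to an algebraic closure of `k`. -/
theorem exists_finiteIndex_sub_mem_nilradical {k R G : Type*} [Field k] [CommRing R] [Algebra k R]
    [Module.Finite k R] [Group G] (σ : G →* (R ≃ₐ[k] R)) :
    ∃ H : Subgroup G, H.FiniteIndex ∧ ∀ g ∈ H, ∀ r, σ g r - r ∈ nilradical R := by
  let π : G →* Equiv.Perm (R →ₐ[k] AlgebraicClosure k) := MonoidHom.toHomPerm
    { toFun := fun g χ => χ.comp (σ g⁻¹).toAlgHom
      map_one' := funext fun χ => AlgHom.ext fun r => by simp; rfl
      map_mul' := fun a b => funext fun χ => AlgHom.ext fun r => by simp; rfl }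
  refine ⟨π.ker, inferInstance, fun g hg r => ?_⟩
  refine mem_nilradical_of_forall_algHom_eq_zero (k := k) fun χ => ?_
  have h : χ.comp (σ g⁻¹).toAlgHom = χ := congrArg (fun p => p χ) (MonoidHom.mem_ker.mp hg)
  have h2 := DFunLike.congr_fun h (σ g r)
  have h3 : σ g⁻¹ (σ g r) = r := by
    rw [← AlgEquiv.mul_apply, ← map_mul]
    simp
  change χ (σ g⁻¹ (σ g r)) = _ at h2
  rw [map_sub, ← h2, h3, sub_self]

theorem Subgroup.finiteIndex_comap {G G' : Type*} [Group G] [Group G'] (f : G →* G')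
    (H : Subgroup G') [H.FiniteIndex] : (H.comap f).FiniteIndex :=
  ⟨by
    rw [Subgroup.index_comap]
    exact (H.instFiniteIndex_subgroupOf f.range).index_ne_zero⟩

theorem MonoidHom.finiteIndex_ker_of_isOfFinOrder {M C : Type*} [Group M] [CommGroup C]
    (ψ : M →* C) {S : Set M} (hS : S.Finite) (hgen : Subgroup.closure S = ⊤)
    (h : ∀ y ∈ S, IsOfFinOrder (ψ y)) : ψ.ker.FiniteIndex := by
  have : Group.FG M := Group.fg_iff.mpr ⟨S, hgen, hS⟩
  have hle : (⊤ : Subgroup M) ≤ (CommGroup.torsion C).comap ψ := by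
    rw [← hgen, Subgroup.closure_le]
    exact h
  have htor : IsMulTorsion ψ.range := by
    rintro ⟨_, m, rfl⟩
    rw [← Submonoid.isOfFinOrder_coe]
    exact hle (Subgroup.mem_top m)
  have := CommGroup.finite_of_fg_isMulTorsion ψ.range htor
  infer_instance

section Transvections
variable {M : Type*} [Group M] {S : Set M}

/-- A finite family of characters stable under automorphisms takes values of finite order at every
element `y` for which there is a transvection `x ↦ x * y`, `y ↦ y`. -/
theorem isOfFinOrder_of_transvection {K X : Type*} [Field K] [Finite X] (ψ : X → M →* Kˣ)
    (hψ : ∀ (φ : MulAut M) (χ : X), ∃ χ', ∀ m, ψ χ' m = ψ χ (φ m))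
    {x y : M} {φ : MulAut M} (hx : φ x = x * y) (hy : φ y = y) (χ : X) :
    IsOfFinOrder (ψ χ y) := by
  choose c hc using hψ
  obtain ⟨s, t, hst, heq⟩ := Finite.exists_ne_map_eq_of_infinite fun t : ℕ => c (φ ^ t) χ
  have hpow : ∀ t : ℕ, (φ ^ t) x = x * y ^ t := by
    intro t
    induction t with
    | zero => simp
    | succ t ih => rw [pow_succ', MulAut.mul_apply, ih, map_mul, map_pow, hx, hy, mul_assoc,
        pow_succ']
  have h : ψ χ y ^ s = ψ χ y ^ t := by
    have h1 := (hc (φ ^ s) χ x).symm.trans ((congrArg (fun z => ψ z x) heq).trans (hc (φ ^ t) χ x))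
    rw [hpow, hpow, map_mul, map_mul] at h1
    simpa using h1
  by_contra hinf
  exact hst (injective_pow_iff_not_isOfFinOrder.mpr hinf h)

/-- The subgroup is the common kernel of the characters `χ ∘ j` of `M`, where `χ` runs over the algebra
homomorphisms from `R` to an algebraic closure of `k`. -/
theorem exists_finiteIndex_sub_one_mem_nilradical {k R : Type*} [Field k] [CommRing R]
    [Algebra k R] [Module.Finite k R]
    (hS : S.Finite) (hgen : Subgroup.closure S = ⊤)
    (htr : ∀ y ∈ S, ∃ (x : M) (φ : MulAut M), φ x = x * y ∧ φ y = y)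
    (σ : MulAut M →* (R ≃ₐ[k] R)) (j : M →* R) (hj : ∀ φ m, σ φ (j m) = j (φ m)) :
    ∃ H : Subgroup M, H.FiniteIndex ∧ ∀ m ∈ H, j m - 1 ∈ nilradical R := by
  let ψ : (R →ₐ[k] AlgebraicClosure k) → M →* (AlgebraicClosure k)ˣ :=
    fun χ => ((χ : R →* AlgebraicClosure k).comp j).toHomUnits
  have hψ : ∀ (φ : MulAut M) χ, ∃ χ', ∀ m, ψ χ' m = ψ χ (φ m) := fun φ χ =>
    ⟨χ.comp (σ φ).toAlgHom, fun m => Units.ext (congrArg χ (hj φ m))⟩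
  refine ⟨⨅ χ, (ψ χ).ker, Subgroup.finiteIndex_iInf fun χ => ?_, fun m hm => ?_⟩
  · refine (ψ χ).finiteIndex_ker_of_isOfFinOrder hS hgen fun y hy => ?_
    obtain ⟨x, φ, h1, h2⟩ := htr y hy
    exact isOfFinOrder_of_transvection ψ hψ h1 h2 χ
  · refine mem_nilradical_of_forall_algHom_eq_zero (k := k) fun χ => ?_
    have h1 : ψ χ m = 1 := (Subgroup.mem_iInf.mp hm) χ
    have h2 : χ (j m) = 1 := congrArg Units.val h1
    rw [map_sub, h2, map_one, sub_self]

theorem MulAut.mul_conj_mul_inv (φ : MulAut M) (m : M) :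
    φ * MulAut.conj m * φ⁻¹ = MulAut.conj (φ m) := by
  ext x
  simp

/-- If `Aut M` acts on `R` and `M` acts through its abelianization, then a subgroup of finite index in
`M` acts unipotently: its operators minus `1` lie in the nilradical `I` of a commutative algebra `E`
of operators on `R`, and `W t` is the set of elements of `R` killed by `I ^ t`. -/
theorem exists_finiteIndex_unipotent_filtration {k R : Type*} [Field k] [CommRing R]
    [Algebra k R] [Module.Finite k R]
    (hS : S.Finite) (hgen : Subgroup.closure S = ⊤)
    (htr : ∀ y ∈ S, ∃ (x : M) (φ : MulAut M), φ x = x * y ∧ φ y = y)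
    (σ : MulAut M →* (R ≃ₐ[k] R))
    (hσ : ∀ m ∈ commutator M, σ (MulAut.conj m) = 1) :
    ∃ (H : Subgroup M) (W : ℕ → Set R) (d : ℕ), H.FiniteIndex ∧ W 0 ⊆ {0} ∧ W d = Set.univ ∧
      ∀ t, ∀ r ∈ W (t + 1), ∀ m ∈ H, σ (MulAut.conj m) r - r ∈ W t := by
  let τ : MulAut M →* (Module.End k R)ˣ := ((AlgEquiv.toLinearMapHom k R).comp σ).toHomUnits
  have hn : (MulAut.conj : M →* MulAut M).range.Normal := ⟨by
    rintro _ ⟨m, rfl⟩ φ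
    exact ⟨φ m, (MulAut.mul_conj_mul_inv φ m).symm⟩⟩
  have hcomm : ∀ x ∈ (MulAut.conj : M →* MulAut M).range,
      ∀ y ∈ (MulAut.conj : M →* MulAut M).range, τ x * τ y = τ y * τ x := by
    rintro _ ⟨x, rfl⟩ _ ⟨y, rfl⟩
    have h := hσ ⁅x, y⁆ (Subgroup.commutator_mem_commutator (Subgroup.mem_top _)
      (Subgroup.mem_top _))
    rw [map_commutatorElement, map_commutatorElement, commutatorElement_eq_one_iff_mul_comm] at h
    ext1
    change AlgEquiv.toLinearMapHom k R (σ (MulAut.conj x)) *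
      AlgEquiv.toLinearMapHom k R (σ (MulAut.conj y)) = _
    rw [← map_mul, h, map_mul]
    rfl
  obtain ⟨E, _, _, _, f, σ', j, hf, hfσ, hfj, -⟩ :=
    exists_commRing_conj_action (k := k) τ _ hcomm
  obtain ⟨H, hH, hHE⟩ := exists_finiteIndex_sub_one_mem_nilradical hS hgen htr σ'
    (j.comp (MulAut.conj : M →* MulAut M).rangeRestrict) fun φ m => hf <| by
      simp only [MonoidHom.comp_apply, hfσ, hfj, MonoidHom.coe_rangeRestrict]
      rw [← MulAut.mul_conj_mul_inv, map_mul, map_mul, map_inv, Units.val_mul, Units.val_mul]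
  have : IsArtinianRing E := IsArtinianRing.of_finite k E
  obtain ⟨d, hd⟩ := IsArtinianRing.isNilpotent_nilradical (R := E)
  refine ⟨H, fun t => {r | ∀ e ∈ nilradical E ^ t, f e r = 0}, d, hH, fun r hr => ?_, ?_, ?_⟩
  · simpa using hr 1 (by simp)
  · ext r
    simp [hd]
  · intro t r hr m hm e he
    have h1 := hr _ (pow_succ (nilradical E) t ▸ Ideal.mul_mem_mul he (hHE m hm))
    have h2 : f (j ((MulAut.conj : M →* MulAut M).rangeRestrict m)) r = σ (MulAut.conj m) r := by
      rw [hfj]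
      rfl
    simpa [h2] using h1

end Transvections

/-- The first part of the theorem, for every metabelian group that is generated by a finite set `S`
such that each `y ∈ S` is fixed by an automorphism sending some `x` to `x * y`. -/
theorem isVirtuallyNilpotent_map_conj_range {k M : Type*} {B : Type u} [Field k] [Ring B]
    [Algebra k B] [Module.Finite k B] [Group M] {S : Set M}
    (hS : S.Finite) (hgen : Subgroup.closure S = ⊤)
    (htr : ∀ y ∈ S, ∃ (x : M) (φ : MulAut M), φ x = x * y ∧ φ y = y)
    (hM : ∀ x ∈ commutator M, ∀ y ∈ commutator M, x * y = y * x) (ρ : MulAut M →* Bˣ) :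
    Group.IsVirtuallyNilpotent ((MulAut.conj : M →* MulAut M).range.map ρ) := by
  -- Replacing `Aut M` by its image in `Bˣ` makes the map from `ρ(M')` to `R` injective.
  let P := ρ.range
  let q : MulAut M →* P := ρ.rangeRestrict
  have hq : Function.Surjective q := ρ.rangeRestrict_surjective
  let ι : M →* P := q.comp MulAut.conj
  have hι : ∀ φ m, q φ * ι m * (q φ)⁻¹ = ι (φ m) := fun φ m => by
    simp only [ι, MonoidHom.comp_apply, ← MulAut.mul_conj_mul_inv, map_mul, map_inv]
  let N : Subgroup P := (commutator M).map ι
  have hN : N.Normal := by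
    refine ⟨?_⟩
    rintro _ ⟨m, hm, rfl⟩ p
    obtain ⟨φ, rfl⟩ := hq p
    rw [hι]
    refine ⟨φ m, ?_, rfl⟩
    have := (inferInstance : (commutator M).Characteristic).fixed φ
    rw [← this] at hm
    exact hm
  have hNcomm : ∀ x ∈ N, ∀ y ∈ N, x * y = y * x := by
    rintro _ ⟨x, hx, rfl⟩ _ ⟨y, hy, rfl⟩
    rw [← map_mul, hM x hx y hy, map_mul]
  obtain ⟨R, _, _, _, f, σ, j, hf, hfσ, hfj, hadj⟩ :=
    exists_commRing_conj_action (k := k) P.subtype N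
    (fun x hx y hy => by rw [← map_mul, hNcomm x hx y hy, map_mul])
  have hσj : ∀ (p : P) (a b : N), (b : P) = p * a * p⁻¹ → σ p (j a) = j b := by
    intro p a b hab
    apply hf
    rw [hfσ, hfj, hfj, hab]
    simp
  have hσN : ∀ x ∈ N, σ x = 1 := by
    intro x hx
    ext r
    have h : (σ x).toAlgHom = AlgHom.id k R := by
      refine AlgHom.ext_of_adjoin_eq_top hadj ?_
      rintro _ ⟨a, rfl⟩
      exact hσj x a a (by rw [hNcomm x hx a a.2, mul_inv_cancel_right])
    exact DFunLike.congr_fun h r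
  obtain ⟨P₁, hP₁, hP₁J⟩ := exists_finiteIndex_sub_mem_nilradical σ
  obtain ⟨H₂, W, d, hH₂, hW0, hWd, hW⟩ := exists_finiteIndex_unipotent_filtration hS hgen htr
    (σ.comp q) (fun m hm => hσN _ ⟨m, hm, rfl⟩)
  let H : Subgroup M := P₁.comap ι ⊓ H₂
  have hH₁ : (P₁.comap ι).FiniteIndex := Subgroup.finiteIndex_comap ι P₁
  have hH : H.FiniteIndex := inferInstance
  let Γ : Subgroup P := H.map ι
  have : IsArtinianRing R := IsArtinianRing.of_finite k R
  have hΓ : Group.IsNilpotent Γ := by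
    refine isNilpotent_of_unipotent_action (σ.comp Γ.subtype) (N.subgroupOf Γ) ?_
      (j.comp ((Γ.subtype.comp (N.subgroupOf Γ).subtype).codRestrict N fun a => a.2)) ?_ ?_
      (nilradical R) IsArtinianRing.isNilpotent_nilradical ?_ W d hW0 hWd ?_
    · rintro ⟨_, x, hx, rfl⟩ ⟨_, y, hy, rfl⟩
      rw [Subgroup.mem_subgroupOf]
      exact ⟨⁅x, y⁆, Subgroup.commutator_mem_commutator (Subgroup.mem_top _)
        (Subgroup.mem_top _), map_commutatorElement _ _ _⟩
    · intro a b hab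
      have := congrArg f hab
      simp only [MonoidHom.comp_apply, hfj] at this
      exact Subtype.ext (Subtype.ext (Subtype.ext (Units.ext this)))
    · intro g a b hab
      exact (hσj g _ _ (congrArg Subtype.val hab)).symm
    · rintro ⟨_, x, hx, rfl⟩ r
      exact hP₁J _ hx.1 r
    · rintro t r hr ⟨_, x, hx, rfl⟩
      exact hW t r hr x hx.2
  let T := (MulAut.conj : M →* MulAut M).range.map ρ
  let θ : M →* T := (ρ.comp MulAut.conj).codRestrict T fun m => ⟨_, ⟨m, rfl⟩, rfl⟩
  have hθ : Function.Surjective θ := by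
    rintro ⟨_, _, ⟨m, rfl⟩, rfl⟩
    exact ⟨m, rfl⟩
  refine ⟨H.map θ, ?_, ⟨ne_zero_of_dvd_ne_zero hH.index_ne_zero (H.index_map_dvd hθ)⟩⟩
  rw [Group.isNilpotent_congr ((H.map θ).equivMapOfInjective T.subtype T.subtype_injective),
    Subgroup.map_map]
  rw [Group.isNilpotent_congr (Γ.equivMapOfInjective P.subtype P.subtype_injective),
    Subgroup.map_map] at hΓ
  exact hΓ

/-! ### Free metabelian groups -/

namespace FreeMetabelianGroup
variable {n : ℕ}

/-- The free generators. -/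
def of (i : Fin n) : FreeMetabelianGroup n := QuotientGroup.mk (FreeGroup.of i)

theorem closure_range_of : Subgroup.closure (Set.range (of : Fin n → _)) = ⊤ := by
  have h := congrArg (Subgroup.map (QuotientGroup.mk' (derivedSeries (FreeGroup (Fin n)) 2)))
    (FreeGroup.closure_range_of (Fin n))
  rw [MonoidHom.map_closure, ← Set.range_comp,
    Subgroup.map_top_of_surjective _ (QuotientGroup.mk'_surjective _)] at h
  exact h

theorem derivedSeries_two_eq_bot : derivedSeries (FreeMetabelianGroup n) 2 = ⊥ := by
  rw [← map_derivedSeries_eq (QuotientGroup.mk'_surjective _), QuotientGroup.map_mk'_self]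

theorem mul_comm_of_mem_commutator (x : FreeMetabelianGroup n) (hx : x ∈ commutator _)
    (y : FreeMetabelianGroup n) (hy : y ∈ commutator _) : x * y = y * x := by
  rw [← derivedSeries_one] at hx hy
  have h : ⁅x, y⁆ ∈ derivedSeries (FreeMetabelianGroup n) 2 :=
    Subgroup.commutator_mem_commutator hx hy
  rw [derivedSeries_two_eq_bot] at h
  exact commutatorElement_eq_one_iff_mul_comm.mp h

/-- The homomorphism to a metabelian group with prescribed values at the free generators. -/
def lift {Q : Type*} [Group Q] (hQ : derivedSeries Q 2 = ⊥) (a : Fin n → Q) :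
    FreeMetabelianGroup n →* Q :=
  QuotientGroup.lift _ (FreeGroup.lift a) fun x hx => by
    have := map_derivedSeries_le_derivedSeries (FreeGroup.lift a) 2 ⟨x, hx, rfl⟩
    rwa [hQ, Subgroup.mem_bot] at this

theorem lift_of {Q : Type*} [Group Q] (hQ : derivedSeries Q 2 = ⊥) (a : Fin n → Q) (i : Fin n) :
    lift hQ a (of i) = a i :=
  FreeGroup.lift_apply_of

theorem hom_ext {Q : Type*} [Group Q] {f g : FreeMetabelianGroup n →* Q}
    (h : ∀ i, f (of i) = g (of i)) : f = g :=
  MonoidHom.eq_of_eqOn_dense closure_range_of (by rintro _ ⟨i, rfl⟩; exact h i)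

theorem exists_transvection {i l : Fin n} (hil : i ≠ l) :
    ∃ φ : MulAut (FreeMetabelianGroup n), φ (of i) = of i * of l ∧ φ (of l) = of l := by
  let t (y : FreeMetabelianGroup n) : FreeMetabelianGroup n →* FreeMetabelianGroup n :=
    lift derivedSeries_two_eq_bot (Function.update of i (of i * y))
  have ti : ∀ y, t y (of i) = of i * y := fun y => (lift_of _ _ _).trans (by simp)
  have tne : ∀ y, ∀ m ≠ i, t y (of m) = of m := fun y m hm => (lift_of _ _ _).trans (by simp [hm])
  have h : ∀ y z, y * z = 1 → t y z = z → (t y).comp (t z) = MonoidHom.id _ := by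
    intro y z hyz hz
    refine hom_ext fun m => ?_
    by_cases hm : m = i
    · subst hm
      simp [ti, hz, mul_assoc, hyz]
    · simp [tne _ m hm]
  have hl : ∀ y, t y (of l) = of l := fun y => tne y l hil.symm
  exact ⟨MonoidHom.toMulEquiv (t (of l)) (t (of l)⁻¹) (h _ _ (by simp) (by simp [hl]))
    (h _ _ (by simp) (by simp [hl])), ti _, hl _⟩

theorem mul_comm_of_le_one (hn : n ≤ 1) (x y : FreeMetabelianGroup n) : x * y = y * x := by
  have : Subsingleton (Fin n) := Fin.subsingleton_iff_le_one.mpr hn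
  have hc : IsMulCommutative (Subgroup.closure (Set.range (of : Fin n → _))) :=
    Subgroup.isMulCommutative_closure (by
      rintro _ ⟨i, rfl⟩ _ ⟨l, rfl⟩
      rw [Subsingleton.elim i l])
  rw [closure_range_of] at hc
  exact congrArg Subtype.val (hc.is_comm.comm ⟨x, trivial⟩ ⟨y, trivial⟩)

theorem isVirtuallyNilpotent_map_conj_range {k : Type*} {B : Type u} [Field k] [Ring B]
    [Algebra k B] [Module.Finite k B] (ρ : MulAut (FreeMetabelianGroup n) →* Bˣ) :
    Group.IsVirtuallyNilpotent
      ((MulAut.conj : FreeMetabelianGroup n →* MulAut (FreeMetabelianGroup n)).range.map ρ) := by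
  rcases Nat.lt_or_ge 1 n with hn | hn
  · refine _root_.isVirtuallyNilpotent_map_conj_range (k := k) (Set.finite_range of)
      closure_range_of ?_ mul_comm_of_mem_commutator ρ
    rintro _ ⟨l, rfl⟩
    have : Nontrivial (Fin n) := Fin.nontrivial_iff_two_le.mpr hn
    obtain ⟨i, hi⟩ := exists_ne l
    obtain ⟨φ, h1, h2⟩ := exists_transvection hi
    exact ⟨of i, φ, h1, h2⟩
  -- In rank at most `1` there are no transvections, but also no nontrivial inner automorphisms.
  · have : (MulAut.conj : FreeMetabelianGroup n →* _).range = ⊥ := by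
      rw [MonoidHom.range_eq_bot_iff]
      exact MonoidHom.ext fun x => MulEquiv.ext fun y => by
        simp [mul_comm_of_le_one hn x y]
    rw [this, Subgroup.map_bot]
    exact Group.IsNilpotent.isVirtuallyNilpotent inferInstance

end FreeMetabelianGroup

/-! ### Affine transformations of the rational line -/

/-- The action of `ℚˣ` on the additive group `ℚ` by multiplication. -/
def rationalDilation : ℚˣ →* MulAut (Multiplicative ℚ) :=
  (MulAutMultiplicative ℚ).symm.toMonoidHom.comp AddAut.mulLeft

theorem rationalDilation_apply (c : ℚˣ) (v : ℚ) :
    rationalDilation c (Multiplicative.ofAdd v) = Multiplicative.ofAdd (c * v) := rfl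

/-- The group of affine transformations `x ↦ c x + v` of `ℚ`. -/
abbrev RationalAffineGroup : Type :=
  Multiplicative ℚ ⋊[rationalDilation] ℚˣ

namespace RationalAffineGroup

/-- The translation `x ↦ x + v`. -/
def translation (v : ℚ) : RationalAffineGroup := SemidirectProduct.inl (Multiplicative.ofAdd v)

/-- The dilation `x ↦ c x`. -/
def dilation (c : ℚˣ) : RationalAffineGroup := SemidirectProduct.inr c

theorem translation_pow (v : ℚ) (N : ℕ) : translation v ^ N = translation (N * v) := by
  rw [translation, ← map_pow, ← ofAdd_nsmul, nsmul_eq_mul, translation]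

theorem dilation_pow (c : ℚˣ) (N : ℕ) : dilation c ^ N = dilation (c ^ N) :=
  (map_pow _ _ _).symm

theorem commutator_translation_dilation (v : ℚ) (c : ℚˣ) :
    ⁅translation v, dilation c⁆ = translation ((1 - c) * v) := by
  rw [commutatorElement_def, translation, dilation, mul_assoc, mul_assoc,
    ← mul_assoc (SemidirectProduct.inr c), ← map_inv SemidirectProduct.inl,
    ← map_inv SemidirectProduct.inr, ← SemidirectProduct.inl_aut, ← map_mul, ← ofAdd_neg,
    rationalDilation_apply, ← ofAdd_add, translation]
  congr 2
  ring

theorem derivedSeries_two_eq_bot : derivedSeries RationalAffineGroup 2 = ⊥ := by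
  have h : derivedSeries RationalAffineGroup 1 ≤ SemidirectProduct.rightHom.ker := by
    rw [derivedSeries_one]
    exact Abelianization.commutator_subset_ker _
  rw [derivedSeries_succ, eq_bot_iff]
  refine (Subgroup.commutator_mono h h).trans ?_
  rw [Subgroup.commutator_le, ← SemidirectProduct.range_inl_eq_ker_rightHom]
  rintro _ ⟨x, rfl⟩ _ ⟨y, rfl⟩
  rw [Subgroup.mem_bot, commutatorElement_eq_one_iff_mul_comm, ← map_mul, mul_comm, map_mul]

/-- Commutators with a dilation by `c ≠ 1` multiply a translation by the nonzero number `1 - c`, so in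
a nilpotent group containing this dilation every translation is trivial. -/
theorem eq_zero_of_mem_nilpotent {K : Subgroup RationalAffineGroup} (hK : Group.IsNilpotent K)
    {c : ℚˣ} (hc : (c : ℚ) ≠ 1) (hcK : dilation c ∈ K) {v : ℚ} (hv : translation v ∈ K) :
    v = 0 := by
  have key : ∀ t : ℕ, ∀ v, ∀ hv : translation v ∈ K,
      (⟨translation v, hv⟩ : K) ∈ Subgroup.upperCentralSeries K t → v = 0 := by
    intro t
    induction t with
    | zero =>
      intro v hv h
      rw [Subgroup.upperCentralSeries_zero, Subgroup.mem_bot, Subtype.ext_iff] at h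
      have h1 := SemidirectProduct.inl_injective (h.trans (map_one SemidirectProduct.inl).symm)
      exact Multiplicative.ofAdd.injective h1
    | succ t ih =>
      intro v hv h
      have h1 := Subgroup.mem_upperCentralSeries_succ_iff.mp h ⟨_, hcK⟩
      have h2 : ((⁅(⟨translation v, hv⟩ : K), (⟨dilation c, hcK⟩ : K)⁆ : K) : RationalAffineGroup) =
          translation ((1 - c) * v) := commutator_translation_dilation v c
      have h4 : translation ((1 - c) * v) ∈ K := h2 ▸ Subtype.property _
      have h5 : (⟨_, h4⟩ : K) = ⁅(⟨translation v, hv⟩ : K), (⟨dilation c, hcK⟩ : K)⁆ :=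
        Subtype.ext h2.symm
      have h3 := ih _ h4 (h5 ▸ h1)
      rcases mul_eq_zero.mp h3 with h4 | h4
      · exact absurd (sub_eq_zero.mp h4).symm hc
      · exact h4
  obtain ⟨t, ht⟩ := hK
  exact key t v hv (ht ▸ Subgroup.mem_top _)

end RationalAffineGroup

/-! ### Virtual nilpotency and linearity -/

open RationalAffineGroup in
theorem FreeMetabelianGroup.not_isVirtuallyNilpotent_conj_range {n : ℕ} (hn : 1 < n) :
    ¬ Group.IsVirtuallyNilpotent
      (MulAut.conj : FreeMetabelianGroup n →* MulAut (FreeMetabelianGroup n)).range := by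
  rintro ⟨H, hH, hHfin⟩
  let c : FreeMetabelianGroup n →* (MulAut.conj : FreeMetabelianGroup n →* _).range :=
    MulAut.conj.rangeRestrict
  let H' := H.comap c
  have hH'fin : H'.FiniteIndex := Subgroup.finiteIndex_comap c H
  have hH' : Group.IsNilpotent H' := by
    refine Subgroup.isNilpotent_of_ker_le_center (c.subgroupComap H) ?_
    intro x hx
    rw [Subgroup.mem_center_iff]
    intro y
    have h1 : c x = 1 := congrArg Subtype.val hx
    have h2 := DFunLike.congr_fun (congrArg Subtype.val h1) (y : FreeMetabelianGroup n)
    have h3 : (x : FreeMetabelianGroup n) * y * (x : FreeMetabelianGroup n)⁻¹ = y := h2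
    exact Subtype.ext (mul_inv_eq_iff_eq_mul.mp h3).symm
  let two : ℚˣ := Units.mk0 2 two_ne_zero
  let f : FreeMetabelianGroup n →* RationalAffineGroup :=
    lift RationalAffineGroup.derivedSeries_two_eq_bot fun i =>
      if i = ⟨0, by lia⟩ then dilation two else translation 1
  have hK : Group.IsNilpotent (H'.map f) :=
    Group.nilpotent_of_surjective (f.subgroupMap H') (f.subgroupMap_surjective H')
  obtain ⟨a, ha, -, haH⟩ :=
    Subgroup.exists_pow_mem_of_index_ne_zero hH'fin.index_ne_zero (of ⟨0, by lia⟩)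
  obtain ⟨b, hb, -, hbH⟩ :=
    Subgroup.exists_pow_mem_of_index_ne_zero hH'fin.index_ne_zero (of ⟨1, by lia⟩)
  have ha' : dilation (two ^ a) ∈ H'.map f := ⟨_, haH, by
    rw [map_pow, lift_of, if_pos rfl, dilation_pow]⟩
  have hb' : translation (b * 1) ∈ H'.map f := ⟨_, hbH, by
    rw [map_pow, lift_of, if_neg (by simp), translation_pow]⟩
  have h2 : ((two ^ a : ℚˣ) : ℚ) ≠ 1 := by
    rw [Units.val_pow_eq_pow_val]
    exact (one_lt_pow₀ (by norm_num [two]) ha.ne').ne'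
  have := eq_zero_of_mem_nilpotent hK h2 ha' hb'
  simp [hb.ne'] at this

theorem theorem1 (n : ℕ) :
    (∀ (k : Type u) [Field k] (V : Type v) [AddCommGroup V] [Module k V] [FiniteDimensional k V]
      (ρ : Representation k (MulAut (FreeMetabelianGroup n)) V),
      Group.IsVirtuallyNilpotent
        ((MulAut.conj : FreeMetabelianGroup n →* MulAut (FreeMetabelianGroup n)).range.map
          ρ.asGroupHom)) ∧
    (1 < n → ¬ IsLinearGroup.{u, 0} (MulAut (FreeMetabelianGroup n))) := by
  refine ⟨fun k _ V _ _ _ ρ =>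
    FreeMetabelianGroup.isVirtuallyNilpotent_map_conj_range (k := k) ρ.asGroupHom, ?_⟩
  rintro hn ⟨k, _, m, -, L, ⟨e⟩⟩
  let ρ : MulAut (FreeMetabelianGroup n) →* (Matrix (Fin m) (Fin m) k)ˣ :=
    L.subtype.comp e.toMonoidHom
  have hρ : Function.Injective ρ := L.subtype_injective.comp e.injective
  obtain ⟨H, hH, hHfin⟩ :=
    FreeMetabelianGroup.isVirtuallyNilpotent_map_conj_range (k := k) ρ
  let E := (MulAut.conj : FreeMetabelianGroup n →* _).range.equivMapOfInjective ρ hρ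
  refine FreeMetabelianGroup.not_isVirtuallyNilpotent_conj_range hn
    ⟨H.comap E.toMonoidHom, ?_, Subgroup.finiteIndex_comap _ _⟩
  exact Subgroup.isNilpotent_of_ker_le_center (E.toMonoidHom.subgroupComap H) fun x hx => by
    have : E x = E 1 := (congrArg Subtype.val hx).trans E.map_one.symm
    have hx1 : x = 1 := Subtype.ext (E.injective this)
    exact hx1 ▸ one_mem _
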